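/- All logarithms are to base 2, with $\log 0=-\infty$. For $p\in[0,1]$ let $\mathcal N_p(\rho)=(1-p)\rho+p\,\mathrm{Tr}(\rho)\,\mathbb 1/2$ be the qubit depolarizing channel. An $(n,N,\lambda_1,\lambda_2)$ identification code for a channel $\mathcal N:A\to B$ consists of density matrices $\rho_1,\dots,\rho_N$ on $A^{\otimes n}$ and operators $0\le D_1,\dots,D_N\le\mathbb 1$ on $B^{\otimes n}$ with $\mathrm{Tr}[\mathcal N^{\otimes n}(\rho_i)D_i]\ge 1-\lambda_1$ for all $i$ and $\mathrm{Tr}[\mathcal N^{\otimes n}(\rho_i)D_j]\le\lambda_2$ for all $i\ne j$. It is simultaneous if there are a POVM $(E_t)_{t=1}^T$ and sets $I_i\subset\{1,\dots,T\}$ with $D_i=\sum_{t\in I_i}E_t$ for all $i$. Let $N(n,\lambda_1,\lambda_2)$ be the largest size $N$ of such a code, $N_{\mathrm{sim}}(n,\lambda_1,\lambda_2)$ the largest size of a simultaneous one, and $$C_{\mathrm{ID}}(\mathcal N)=\inf_{\lambda_1,\lambda_2>0}\ \liminf_{n\to\infty}\tfrac1n\log\log N(n,\lambda_1,\lambda_2),$$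 with $C^{\mathrm{sim}}_{\mathrm{ID}}(\mathcal N)$ defined in the same way from $N_{\mathrm{sim}}$. Put $\gamma(p)=-\frac{1}{2\log(1-p)}$ and $D(x\|y)=x\log\frac xy+(1-x)\log\frac{1-x}{1-y}$. **Theorem.** Let $0\le p<1$ and let $\lambda_1,\lambda_2>0$ with $\lambda_1+\lambda_2<1$. Then, with $N(n,\lambda_1,\lambda_2)$ computed for the channel $\mathcal N_p$, $$C_{\mathrm{ID}}(\mathcal N_p)\ \le\ \limsup_{n\to\infty}\tfrac1n\log\log N(n,\lambda_1,\lambda_2)\ \le\ \begin{cases}2,&0\le p\le 1-2^{-2/3},\\ 2-D\bigl(\gamma(p)\,\big\|\,\tfrac34\bigr),&1-2^{-2/3}\le p<1.\end{cases}$$ The same inequalities hold with $C^{\mathrm{sim}}_{\mathrm{ID}}$ and $N_{\mathrm{sim}}$ in place of $C_{\mathrm{ID}}$ and $N$. Moreover, $2-D(\gamma(p)\|\tfrac34)\to0$ as $p\to1^-$. -/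

import Mathlib

open Filter Topology
open scoped ENNReal ComplexOrder

noncomputable section

namespace QuantumId

variable {A B : Type*} [Fintype A] [DecidableEq A]

/-- The operator `X₁ ⊗ ⋯ ⊗ Xₙ` on the `n`-fold tensor product, in the product basis. -/
def tensorMatrix {n : ℕ} (X : Fin n → Matrix A A ℂ) :
    Matrix (Fin n → A) (Fin n → A) ℂ :=
  Matrix.of fun a b => ∏ k, X k (a k) (b k)

/-- The `n`-fold tensor power `Φ^{⊗ n}` of a linear map `Φ` on matrices, given by
`|c₁⋯cₙ⟩⟨d₁⋯dₙ| ↦ Φ(|c₁⟩⟨d₁|) ⊗ ⋯ ⊗ Φ(|cₙ⟩⟨dₙ|)`. -/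
def tensorPower (Φ : Matrix A A ℂ →ₗ[ℂ] Matrix B B ℂ) (n : ℕ) :
    Matrix (Fin n → A) (Fin n → A) ℂ →ₗ[ℂ] Matrix (Fin n → B) (Fin n → B) ℂ where
  toFun X := ∑ c, ∑ d, X c d • tensorMatrix fun k => Φ (Matrix.single (c k) (d k) 1)
  map_add' X Y := by simp [add_smul, Finset.sum_add_distrib]
  map_smul' r X := by simp [mul_smul, Finset.smul_sum]

/-- `Φ^{⊗ n}` acts factor by factor on product operators. -/
theorem tensorPower_tensorMatrix (Φ : Matrix A A ℂ →ₗ[ℂ] Matrix B B ℂ) (n : ℕ)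
    (X : Fin n → Matrix A A ℂ) :
    tensorPower Φ n (tensorMatrix X) = tensorMatrix fun k => Φ (X k) := by
  have hΦ : ∀ (Y : Matrix A A ℂ) (a b : B),
      Φ Y a b = ∑ c, ∑ d, Y c d * Φ (Matrix.single c d 1) a b := by
    intro Y a b
    conv_lhs => rw [Matrix.matrix_eq_sum_single Y]
    have h : ∀ c d, Matrix.single c d (Y c d) = Y c d • Matrix.single c d (1 : ℂ) := by
      intro c d; simp [Matrix.smul_single]
    simp only [h, map_sum, map_smul, Matrix.sum_apply, Matrix.smul_apply, smul_eq_mul]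
  ext a b
  simp only [tensorPower, tensorMatrix, LinearMap.coe_mk, AddHom.coe_mk, Matrix.sum_apply,
    Matrix.smul_apply, smul_eq_mul, Matrix.of_apply, ← Finset.prod_mul_distrib]
  simp only [hΦ (X _), Finset.prod_univ_sum, Fintype.piFinset_univ]

variable [Fintype B] [DecidableEq B]

/-- Density matrices: positive semidefinite matrices of unit trace. -/
def IsState (ρ : Matrix A A ℂ) : Prop := ρ.PosSemidef ∧ ρ.trace = 1

/-- Effects (test operators): `0 ≤ E ≤ 1`, so that `(E, 1 - E)` is a binary POVM. -/
def IsEffect (E : Matrix A A ℂ) : Prop := E.PosSemidef ∧ (1 - E).PosSemidef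

/-- An `(n, N, lam₁, lam₂)` classical identification code for the channel `Φ`: states `ρ i` on `n`
copies of the input system, effects `D i` on `n` copies of the output system, with type-I error
at most `lam₁` and type-II error at most `lam₂`. -/
structure IsIdCode (Φ : Matrix A A ℂ →ₗ[ℂ] Matrix B B ℂ) (n N : ℕ) (lam₁ lam₂ : ℝ)
    (ρ : Fin N → Matrix (Fin n → A) (Fin n → A) ℂ)
    (D : Fin N → Matrix (Fin n → B) (Fin n → B) ℂ) : Prop where
  isState : ∀ i, IsState (ρ i)
  isEffect : ∀ i, IsEffect (D i)
  typeI : ∀ i, 1 - lam₁ ≤ (tensorPower Φ n (ρ i) * D i).trace.re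
  typeII : ∀ i j, i ≠ j → (tensorPower Φ n (ρ i) * D j).trace.re ≤ lam₂

/-- A family of effects is coexistent if it is obtained by coarse-graining one POVM `(E t)`. -/
def IsCoexistent {N : ℕ} (D : Fin N → Matrix B B ℂ) : Prop :=
  ∃ (T : ℕ) (E : Fin T → Matrix B B ℂ) (I : Fin N → Finset (Fin T)),
    (∀ t, (E t).PosSemidef) ∧ ∑ t, E t = 1 ∧ ∀ i, D i = ∑ t ∈ I i, E t

/-- `N(n, lam₁, lam₂)`: the largest size of an identification code (`⊤` if unbounded). -/
def maxSize (Φ : Matrix A A ℂ →ₗ[ℂ] Matrix B B ℂ) (n : ℕ) (lam₁ lam₂ : ℝ) : ℕ∞ :=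
  ⨆ (N : ℕ) (_ : ∃ ρ D, IsIdCode Φ n N lam₁ lam₂ ρ D), (N : ℕ∞)

/-- `N_sim(n, lam₁, lam₂)`: the largest size of a simultaneous identification code. -/
def maxSimSize (Φ : Matrix A A ℂ →ₗ[ℂ] Matrix B B ℂ) (n : ℕ) (lam₁ lam₂ : ℝ) : ℕ∞ :=
  ⨆ (N : ℕ) (_ : ∃ ρ D, IsIdCode Φ n N lam₁ lam₂ ρ D ∧ IsCoexistent D), (N : ℕ∞)

/-- The logarithm to base `2` with `log2 0 = ⊥` and `log2 ∞ = ⊤`. -/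
def log2 (x : ℝ≥0∞) : EReal := ENNReal.log x / ((Real.log 2 : ℝ) : EReal)

/-- `(1 / n) log log N` to base `2`, for a code size `N ≥ 1`; the value is `⊥` for `N = 1`. -/
def doubleLogRate (n : ℕ) (N : ℕ∞) : EReal :=
  log2 (log2 (N : ℝ≥0∞)).toENNReal / (n : EReal)

/-- `limsup (1 / n) log log N(n)` for a sequence of code sizes. -/
def upperRate (N : ℕ → ℕ∞) : EReal := limsup (fun n => doubleLogRate n (N n)) atTop

/-- `liminf (1 / n) log log N(n)` for a sequence of code sizes. -/
def lowerRate (N : ℕ → ℕ∞) : EReal := liminf (fun n => doubleLogRate n (N n)) atTop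

/-- The (unrestricted) classical identification capacity. -/
def idCapacity (Φ : Matrix A A ℂ →ₗ[ℂ] Matrix B B ℂ) : EReal :=
  ⨅ (lam₁ : ℝ) (_ : 0 < lam₁) (lam₂ : ℝ) (_ : 0 < lam₂),
    lowerRate fun n => maxSize Φ n lam₁ lam₂

/-- The simultaneous classical identification capacity. -/
def simIdCapacity (Φ : Matrix A A ℂ →ₗ[ℂ] Matrix B B ℂ) : EReal :=
  ⨅ (lam₁ : ℝ) (_ : 0 < lam₁) (lam₂ : ℝ) (_ : 0 < lam₂),
    lowerRate fun n => maxSimSize Φ n lam₁ lam₂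

/-- The qubit depolarizing channel `X ↦ (1 - p) X + p Tr(X) 1 / 2`. -/
def depolarizing (p : ℝ) : Matrix (Fin 2) (Fin 2) ℂ →ₗ[ℂ] Matrix (Fin 2) (Fin 2) ℂ where
  toFun X := (1 - p : ℂ) • X + (p * X.trace / 2 : ℂ) • (1 : Matrix (Fin 2) (Fin 2) ℂ)
  map_add' X Y := by
    simp only [smul_add, Matrix.trace_add, mul_add, add_div, add_smul]
    abel
  map_smul' r X := by
    simp only [Matrix.trace_smul, smul_eq_mul, RingHom.id_apply, smul_add, smul_smul]
    ring_nf

/-- The binary relative entropy `D(x ‖ y)` to base `2`. -/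
def binRelEntropy (x y : ℝ) : ℝ :=
  x * Real.logb 2 (x / y) + (1 - x) * Real.logb 2 ((1 - x) / (1 - y))

/-- `γ(p) = -1 / (2 log₂ (1 - p))`, for `0 < p < 1`. -/
def gammaParam (p : ℝ) : ℝ := -1 / (2 * Real.logb 2 (1 - p))

end QuantumId

end

/-!
The tensor power of the depolarizing channel is diagonal in the basis of Pauli strings `P_s`: it
multiplies the coefficient `Tr (ρ P_s)` by `(1 - p) ^ weight s`
(`tensorPower_depolarizing`). A state has purity at most `1` and an effect on `n` qubits has
`Tr D² ≤ 2 ^ n`, so by the Cauchy-Schwarz inequality and Parseval's identity the Pauli strings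
with `(1 - p) ^ (2 * weight s) * 2 ^ n` small hardly influence any outcome probability
(`sq_trace_tensorPower_depolarizing_sub_le`). This condition holds as soon as the weight exceeds
`γ(p) n` by a constant, because `(1 - p) ^ (2 * γ(p)) = 1 / 2`.

In an identification code with `lam₁ + lam₂ < 1` the outputs of distinct codewords are told apart
by an effect with bias at least `1 - lam₁ - lam₂`. Hence the codewords have distinct low-weight
Pauli coefficients even after rounding to a grid of exponentially small mesh. With `d` low-weight
strings, the pigeonhole principle bounds the size of the code by `(C * 4 ^ n) ^ d`
(`IsIdCode.size_le`), so the double-logarithmic rate is at most the exponential growth rate of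
`d`. In general `d ≤ 4 ^ n`, which gives the bound `2`. If `γ(p) ≤ 3 / 4`, that is
`p ≥ 1 - 2 ^ (-2 / 3)`, the Chernoff bound (`card_filter_weight_le`) gives
`d ≤ C * 2 ^ (n * (2 - D(γ(p) ‖ 3 / 4)))`.

The lower bounds hold because an infimum of lower limits is at most each upper limit, and a
simultaneous code is a code. Finally `γ(p) → 0` as `p → 1`, and `D(0 ‖ 3 / 4) = 2`.
-/

namespace QuantumId

open Matrix

/-! ### Traces of products of positive semidefinite matrices -/

open scoped MatrixOrder Matrix.Norms.L2Operator in
theorem trace_mul_re_nonneg {A : Type*} [Fintype A] [DecidableEq A] {X Y : Matrix A A ℂ}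
    (hX : X.PosSemidef) (hY : Y.PosSemidef) : 0 ≤ (X * Y).trace.re := by
  obtain ⟨C, rfl⟩ := CStarAlgebra.nonneg_iff_eq_star_mul_self.1 hX.nonneg
  rw [Matrix.star_eq_conjTranspose, Matrix.mul_assoc, Matrix.trace_mul_comm]
  exact (Complex.le_def.1 (hY.mul_mul_conjTranspose_same C).trace_nonneg).1

theorem IsEffect.trace_mul_self_re_le {A : Type*} [Fintype A] [DecidableEq A]
    {D : Matrix A A ℂ} (hD : IsEffect D) : (D * D).trace.re ≤ Fintype.card A := by
  have h₁ := trace_mul_re_nonneg hD.1 hD.2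
  have h₂ := (Complex.le_def.1 hD.2.trace_nonneg).1
  rw [Matrix.mul_sub, Matrix.mul_one, Matrix.trace_sub, Complex.sub_re] at h₁
  rw [Matrix.trace_sub, Matrix.trace_one, Complex.sub_re, Complex.natCast_re,
    Complex.zero_re] at h₂
  linarith

/-- The purity `Tr ρ²` of a state is at most `1`, since `|ρ_ab|² ≤ ρ_aa ρ_bb`. -/
theorem IsState.trace_mul_self_re_le {A : Type*} [Fintype A] [DecidableEq A]
    {ρ : Matrix A A ℂ} (hρ : IsState ρ) : (ρ * ρ).trace.re ≤ 1 := by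
  have hdiag : ∀ a, ((ρ a a).re : ℂ) = ρ a a := fun a => by
    have := hρ.1.isHermitian.coe_re_apply_self a
    simpa using this
  have hentry : ∀ a b, (ρ a b * ρ b a).re ≤ (ρ a a).re * (ρ b b).re := fun a b => by
    have h := (Complex.le_def.1 (hρ.1.submatrix ![a, b]).det_nonneg).1
    rw [Matrix.det_fin_two] at h
    simp only [Matrix.submatrix_apply, Matrix.cons_val_zero, Matrix.cons_val_one,
      Complex.sub_re, Complex.zero_re] at h
    rw [← hdiag a, ← hdiag b, ← Complex.ofReal_mul, Complex.ofReal_re] at h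
    linarith
  have htr : ∑ a, (ρ a a).re = 1 := by
    have := congrArg Complex.re hρ.2
    simpa [Matrix.trace] using this
  calc (ρ * ρ).trace.re = ∑ a, ∑ b, (ρ a b * ρ b a).re := by
        simp [Matrix.trace, Matrix.mul_apply]
    _ ≤ ∑ a, ∑ b, (ρ a a).re * (ρ b b).re :=
        Finset.sum_le_sum fun a _ => Finset.sum_le_sum fun b _ => hentry a b
    _ = 1 := by rw [← Finset.sum_mul_sum, htr, one_mul]

/-! ### The Pauli expansion of the depolarizing channel -/

/-- The Pauli matrices `1, σ_x, σ_y, σ_z`, indexed by `0, 1, 2, 3`. -/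
def pauli : Fin 4 → Matrix (Fin 2) (Fin 2) ℂ :=
  ![1, !![0, 1; 1, 0], !![0, -Complex.I; Complex.I, 0], !![1, 0; 0, -1]]

/-- The Pauli string `σ_{s₁} ⊗ ⋯ ⊗ σ_{sₙ}`. -/
def pauliString {n : ℕ} (s : Fin n → Fin 4) : Matrix (Fin n → Fin 2) (Fin n → Fin 2) ℂ :=
  tensorMatrix fun k => pauli (s k)

/-- The weight of a Pauli string: the number of its factors different from the identity. -/
def weight {n : ℕ} (s : Fin n → Fin 4) : ℕ := ∑ k, if s k = 0 then 0 else 1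

theorem prod_ite_eq_pow_weight {R : Type*} [CommMonoid R] {n : ℕ} (s : Fin n → Fin 4) (r : R) :
    ∏ k, (if s k = 0 then 1 else r) = r ^ weight s := by
  rw [weight, ← Finset.prod_pow_eq_pow_sum]
  exact Finset.prod_congr rfl fun k _ => by split_ifs <;> simp

theorem pauli_isHermitian (s : Fin 4) : (pauli s).IsHermitian := by
  ext a b
  fin_cases s <;> fin_cases a <;> fin_cases b <;> simp [pauli]

theorem pauliString_isHermitian {n : ℕ} (s : Fin n → Fin 4) : (pauliString s).IsHermitian := by
  ext a b
  simp only [pauliString, tensorMatrix, conjTranspose_apply, of_apply, star_prod]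
  exact Finset.prod_congr rfl fun k _ => (pauli_isHermitian (s k)).apply _ _

/-- The one-qubit Pauli expansion of the depolarizing channel on matrix units. -/
theorem depolarizing_single (p : ℝ) (c d a b : Fin 2) :
    depolarizing p (Matrix.single c d 1) a b =
      ∑ s, (if s = 0 then 1 else (1 - p : ℂ)) / 2 * pauli s d c * pauli s a b := by
  have hI := Complex.I_mul_I
  fin_cases a <;> fin_cases b <;> fin_cases c <;> fin_cases d <;>
    simp [depolarizing, pauli, Fin.sum_univ_four, Matrix.trace, Fin.sum_univ_two] <;>
    first
      | ring1
      | linear_combination ((1 - p : ℂ) / 2) * hI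
      | linear_combination (-(1 - p : ℂ) / 2) * hI

/-- The tensor power of the depolarizing channel is diagonal in the basis of Pauli strings, which
it contracts by `(1 - p) ^ weight`. -/
theorem tensorPower_depolarizing (p : ℝ) (n : ℕ)
    (X : Matrix (Fin n → Fin 2) (Fin n → Fin 2) ℂ) :
    tensorPower (depolarizing p) n X =
      ∑ s : Fin n → Fin 4,
        ((1 - p : ℂ) ^ weight s / 2 ^ n * (X * pauliString s).trace) • pauliString s := by
  have hcoef : ∀ s : Fin n → Fin 4,
      (1 - p : ℂ) ^ weight s / 2 ^ n = ∏ k, (if s k = 0 then 1 else (1 - p : ℂ)) / 2 := fun s => by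
    rw [Finset.prod_div_distrib, prod_ite_eq_pow_weight]
    simp
  ext a b
  simp only [tensorPower, LinearMap.coe_mk, AddHom.coe_mk, Matrix.sum_apply, Matrix.smul_apply,
    smul_eq_mul, tensorMatrix, of_apply, depolarizing_single, Finset.prod_univ_sum,
    Fintype.piFinset_univ, Matrix.trace, Matrix.diag, Matrix.mul_apply, pauliString, hcoef,
    Finset.mul_sum, Finset.sum_mul, Finset.prod_mul_distrib]
  refine (Finset.sum_congr rfl fun c _ => Finset.sum_comm).trans (Finset.sum_comm.trans ?_)
  refine Finset.sum_congr rfl fun s _ => Finset.sum_congr rfl fun c _ =>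
    Finset.sum_congr rfl fun d _ => ?_
  ring

theorem tensorPower_depolarizing_zero (n : ℕ) (X : Matrix (Fin n → Fin 2) (Fin n → Fin 2) ℂ) :
    tensorPower (depolarizing 0) n X = X := by
  have h : ∀ Y, depolarizing 0 Y = Y := fun Y => by simp [depolarizing]
  ext a b
  simp only [tensorPower, LinearMap.coe_mk, AddHom.coe_mk, Matrix.sum_apply, Matrix.smul_apply,
    smul_eq_mul, tensorMatrix, of_apply, h, Matrix.single_apply, Finset.prod_ite_zero]
  simp [← funext_iff, forall_and, ite_and]

/-- The Pauli coefficient `Tr (X P_s)`, which is real for Hermitian `X`. -/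
def pauliCoeff {n : ℕ} (X : Matrix (Fin n → Fin 2) (Fin n → Fin 2) ℂ) (s : Fin n → Fin 4) : ℝ :=
  (X * pauliString s).trace.re

theorem coe_pauliCoeff {n : ℕ} {X : Matrix (Fin n → Fin 2) (Fin n → Fin 2) ℂ}
    (hX : X.IsHermitian) (s : Fin n → Fin 4) :
    (pauliCoeff X s : ℂ) = (X * pauliString s).trace := by
  refine Complex.conj_eq_iff_re.1 ?_
  rw [← Complex.star_def, ← Matrix.trace_conjTranspose, Matrix.conjTranspose_mul, hX.eq,
    (pauliString_isHermitian s).eq, Matrix.trace_mul_comm]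

/-- The outcome probabilities of the depolarizing channel in terms of Pauli coefficients. -/
theorem trace_tensorPower_depolarizing_mul {n : ℕ} (p : ℝ)
    {X D : Matrix (Fin n → Fin 2) (Fin n → Fin 2) ℂ} (hX : X.IsHermitian) (hD : D.IsHermitian) :
    (tensorPower (depolarizing p) n X * D).trace.re =
      ∑ s, (1 - p) ^ weight s * pauliCoeff X s * pauliCoeff D s / 2 ^ n := by
  rw [tensorPower_depolarizing, Finset.sum_mul, Matrix.trace_sum, Complex.re_sum]
  refine Finset.sum_congr rfl fun s _ => ?_
  rw [Matrix.smul_mul, Matrix.trace_smul, Matrix.trace_mul_comm (pauliString s), smul_eq_mul,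
    ← coe_pauliCoeff hX, ← coe_pauliCoeff hD]
  rw [← Complex.ofReal_re ((1 - p) ^ weight s * pauliCoeff X s * pauliCoeff D s / 2 ^ n)]
  congr 1
  push_cast
  ring

/-- Parseval's identity for the Pauli strings: the expansion of the channel at `p = 0`. -/
theorem sum_pauliCoeff_sq {n : ℕ} {X : Matrix (Fin n → Fin 2) (Fin n → Fin 2) ℂ}
    (hX : X.IsHermitian) : ∑ s, pauliCoeff X s ^ 2 = 2 ^ n * (X * X).trace.re := by
  have h := trace_tensorPower_depolarizing_mul 0 hX hX
  rw [tensorPower_depolarizing_zero, ← Finset.sum_div] at h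
  rw [h, mul_div_cancel₀ _ (by positivity)]
  simp [sq]

theorem IsEffect.sum_pauliCoeff_sq_le {n : ℕ} {D : Matrix (Fin n → Fin 2) (Fin n → Fin 2) ℂ}
    (hD : IsEffect D) : ∑ s, pauliCoeff D s ^ 2 ≤ 2 ^ n * 2 ^ n := by
  rw [sum_pauliCoeff_sq hD.1.isHermitian]
  have h := hD.trace_mul_self_re_le
  simp only [Fintype.card_pi, Fintype.card_fin, Finset.prod_const, Finset.card_univ,
    Nat.cast_pow, Nat.cast_ofNat] at h
  gcongr

theorem IsState.sum_pauliCoeff_sq_le {n : ℕ} {ρ : Matrix (Fin n → Fin 2) (Fin n → Fin 2) ℂ}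
    (hρ : IsState ρ) : ∑ s, pauliCoeff ρ s ^ 2 ≤ 2 ^ n := by
  rw [sum_pauliCoeff_sq hρ.1.isHermitian]
  exact mul_le_of_le_one_right (by positivity) hρ.trace_mul_self_re_le

theorem IsState.abs_pauliCoeff_le {n : ℕ} {ρ : Matrix (Fin n → Fin 2) (Fin n → Fin 2) ℂ}
    (hρ : IsState ρ) (s : Fin n → Fin 4) : |pauliCoeff ρ s| ≤ 2 ^ n := by
  refine abs_le_of_sq_le_sq ?_ (by positivity)
  calc pauliCoeff ρ s ^ 2 ≤ ∑ t, pauliCoeff ρ t ^ 2 :=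
        Finset.single_le_sum (f := fun t => pauliCoeff ρ t ^ 2) (fun t _ => sq_nonneg _)
          (Finset.mem_univ s)
    _ ≤ 2 ^ n := hρ.sum_pauliCoeff_sq_le
    _ ≤ (2 ^ n) ^ 2 := le_self_pow₀ (one_le_pow₀ one_le_two) two_ne_zero

/-! ### Packing codewords by their quantized low-weight Pauli coefficients -/

/-- Two states whose Pauli coefficients agree up to `η` on `S` have outputs which no effect
distinguishes well, provided that the channel is strongly contracting off `S`. -/
theorem sq_trace_tensorPower_depolarizing_sub_le {p : ℝ} (hp0 : 0 ≤ p) (hp1 : p < 1) {n : ℕ}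
    {ρ ρ' D : Matrix (Fin n → Fin 2) (Fin n → Fin 2) ℂ} (hρ : IsState ρ) (hρ' : IsState ρ')
    (hD : IsEffect D) (S : Finset (Fin n → Fin 4)) {η τ : ℝ} (hτ0 : 0 ≤ τ)
    (hη : ∀ s ∈ S, |pauliCoeff ρ s - pauliCoeff ρ' s| ≤ η)
    (hτ : ∀ s ∉ S, ((1 - p) ^ weight s) ^ 2 * 2 ^ n ≤ τ) :
    ((tensorPower (depolarizing p) n ρ * D).trace.re -
      (tensorPower (depolarizing p) n ρ' * D).trace.re) ^ 2 ≤ 4 ^ n * η ^ 2 + 4 * τ := by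
  set g : (Fin n → Fin 4) → ℝ := fun s =>
    (1 - p) ^ weight s * (pauliCoeff ρ s - pauliCoeff ρ' s) with hg
  have hdiff : (tensorPower (depolarizing p) n ρ * D).trace.re -
      (tensorPower (depolarizing p) n ρ' * D).trace.re =
        (∑ s, g s * pauliCoeff D s) / 2 ^ n := by
    rw [trace_tensorPower_depolarizing_mul p hρ.1.isHermitian hD.1.isHermitian,
      trace_tensorPower_depolarizing_mul p hρ'.1.isHermitian hD.1.isHermitian,
      ← Finset.sum_sub_distrib, Finset.sum_div]
    exact Finset.sum_congr rfl fun s _ => by simp only [hg]; ring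
  -- On `S` the first summand bounds `g s ^ 2`, off `S` the second one.
  have hpt : ∀ s, g s ^ 2 ≤
      η ^ 2 + τ / 2 ^ n * (2 * (pauliCoeff ρ s ^ 2 + pauliCoeff ρ' s ^ 2)) := fun s => by
    rw [hg, mul_pow]
    by_cases hs : s ∈ S
    · have h1 : ((1 - p) ^ weight s) ^ 2 ≤ 1 :=
        pow_le_one₀ (by have := sub_pos.2 hp1; positivity)
          (pow_le_one₀ (by linarith) (by linarith))
      have h2 : (pauliCoeff ρ s - pauliCoeff ρ' s) ^ 2 ≤ η ^ 2 :=
        sq_le_sq.2 ((hη s hs).trans (le_abs_self η))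
      have h3 : 0 ≤ τ / 2 ^ n * (2 * (pauliCoeff ρ s ^ 2 + pauliCoeff ρ' s ^ 2)) := by positivity
      calc _ ≤ 1 * η ^ 2 := by gcongr
        _ ≤ _ := by linarith
    · have h1 : ((1 - p) ^ weight s) ^ 2 ≤ τ / 2 ^ n :=
        (le_div_iff₀ (by positivity)).2 (hτ s hs)
      have h2 : (pauliCoeff ρ s - pauliCoeff ρ' s) ^ 2 ≤
          2 * (pauliCoeff ρ s ^ 2 + pauliCoeff ρ' s ^ 2) := by
        nlinarith [sq_nonneg (pauliCoeff ρ s + pauliCoeff ρ' s)]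
      calc _ ≤ τ / 2 ^ n * (2 * (pauliCoeff ρ s ^ 2 + pauliCoeff ρ' s ^ 2)) := by gcongr
        _ ≤ _ := by linarith [sq_nonneg η]
  have hcard : (Fintype.card (Fin n → Fin 4) : ℝ) = 4 ^ n := by simp
  have hsum : ∑ s, g s ^ 2 ≤ 4 ^ n * η ^ 2 + 4 * τ :=
    calc ∑ s, g s ^ 2
        ≤ ∑ s, (η ^ 2 + τ / 2 ^ n * (2 * (pauliCoeff ρ s ^ 2 + pauliCoeff ρ' s ^ 2))) :=
          Finset.sum_le_sum fun s _ => hpt s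
      _ = 4 ^ n * η ^ 2 + τ / 2 ^ n *
            (2 * (∑ s, pauliCoeff ρ s ^ 2 + ∑ s, pauliCoeff ρ' s ^ 2)) := by
          rw [Finset.sum_add_distrib, Finset.sum_const, Finset.card_univ, nsmul_eq_mul, hcard,
            ← Finset.mul_sum, ← Finset.mul_sum, Finset.sum_add_distrib]
      _ ≤ 4 ^ n * η ^ 2 + τ / 2 ^ n * (2 * (2 ^ n + 2 ^ n)) := by
          gcongr
          exacts [hρ.sum_pauliCoeff_sq_le, hρ'.sum_pauliCoeff_sq_le]
      _ = 4 ^ n * η ^ 2 + 4 * τ := by field_simp; ring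
  rw [hdiff, div_pow, div_le_iff₀ (by positivity)]
  calc (∑ s, g s * pauliCoeff D s) ^ 2
      ≤ (∑ s, g s ^ 2) * ∑ s, pauliCoeff D s ^ 2 := Finset.sum_mul_sq_le_sq_mul_sq _ _ _
    _ ≤ (4 ^ n * η ^ 2 + 4 * τ) * (2 ^ n * 2 ^ n) := by
        gcongr
        exact hD.sum_pauliCoeff_sq_le
    _ = _ := by ring

/-- The size of a code is bounded by the number of cells of a grid in the Pauli coefficients
indexed by `S`, because the outputs of distinct codewords are distinguished by an effect. -/
theorem IsIdCode.size_le {p : ℝ} (hp0 : 0 ≤ p) (hp1 : p < 1) {n N : ℕ} {lam₁ lam₂ : ℝ}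
    {ρ D : Fin N → Matrix (Fin n → Fin 2) (Fin n → Fin 2) ℂ}
    (h : IsIdCode (depolarizing p) n N lam₁ lam₂ ρ D) (hlam : lam₁ + lam₂ < 1)
    (S : Finset (Fin n → Fin 4))
    (hS : ∀ s ∉ S, ((1 - p) ^ weight s) ^ 2 * 2 ^ n ≤ (1 - lam₁ - lam₂) ^ 2 / 8) :
    N ≤ ⌊(4 / (1 - lam₁ - lam₂) + 3) * 4 ^ n⌋₊ ^ S.card := by
  set δ := 1 - lam₁ - lam₂ with hδdef
  have hδ : 0 < δ := by linarith
  -- With this mesh the bound `4 ^ n * η ^ 2` on the contribution of `S` to the squared bias is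
  -- `δ ^ 2 / 4`, while the remaining strings contribute at most `δ ^ 2 / 2`.
  set η := δ / 2 ^ (n + 1) with hη
  have hη0 : 0 < η := by positivity
  set K := ⌈2 ^ n / η⌉₊ with hK
  have hcell : ∀ i s, ⌊pauliCoeff (ρ i) s / η⌋ ∈ Finset.Icc (-(K : ℤ)) K := fun i s => by
    have h1 := (h.isState i).abs_pauliCoeff_le s
    have h2 : |pauliCoeff (ρ i) s / η| ≤ K := by
      rw [abs_div, abs_of_pos hη0]
      exact (div_le_div_of_nonneg_right h1 hη0.le).trans (Nat.le_ceil _)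
    rw [abs_le] at h2
    rw [Finset.mem_Icc, Int.le_floor]
    exact ⟨by exact_mod_cast h2.1, by exact_mod_cast (Int.floor_le _).trans h2.2⟩
  let f : Fin N → (S → Finset.Icc (-(K : ℤ)) K) := fun i s => ⟨_, hcell i s⟩
  have hf : Function.Injective f := fun i j hij => by
    by_contra hne
    have hclose : ∀ s ∈ S, |pauliCoeff (ρ i) s - pauliCoeff (ρ j) s| ≤ η := fun s hs => by
      have := Int.abs_sub_lt_one_of_floor_eq_floor
        (congrArg Subtype.val (congrFun hij ⟨s, hs⟩))
      rw [← sub_div, abs_div, abs_of_pos hη0, div_lt_one hη0] at this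
      exact this.le
    have hsq := sq_trace_tensorPower_depolarizing_sub_le hp0 hp1 (h.isState i) (h.isState j)
      (h.isEffect i) S (by positivity) hclose hS
    have hgap : δ ≤ (tensorPower (depolarizing p) n (ρ i) * D i).trace.re -
        (tensorPower (depolarizing p) n (ρ j) * D i).trace.re := by
      linarith [h.typeI i, h.typeII j i (Ne.symm hne)]
    have h4 : (4 : ℝ) ^ n * η ^ 2 = δ ^ 2 / 4 := by
      have : (4 : ℝ) ^ n = 2 ^ n * 2 ^ n := by rw [← mul_pow]; norm_num
      rw [hη, this]
      field_simp
      ring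
    have := pow_le_pow_left₀ hδ.le hgap 2
    nlinarith
  have hcard : Fintype.card (S → Finset.Icc (-(K : ℤ)) K) = (2 * K + 1) ^ S.card := by
    simp only [Fintype.card_pi, Fintype.card_coe, Int.card_Icc, Finset.prod_const,
      Finset.card_univ]
    congr 1
    omega
  have hN := Fintype.card_le_of_injective f hf
  rw [Fintype.card_fin, hcard] at hN
  refine hN.trans (Nat.pow_le_pow_left (Nat.le_floor ?_) _)
  have hKle : (K : ℝ) ≤ 2 * 4 ^ n / δ + 1 := by
    have h1 : (2 : ℝ) ^ n / η = 2 * 4 ^ n / δ := by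
      have : (4 : ℝ) ^ n = 2 ^ n * 2 ^ n := by rw [← mul_pow]; norm_num
      rw [hη, this]
      field_simp
      ring
    rw [← h1]
    exact (Nat.ceil_lt_add_one (by positivity)).le
  have h4n : (1 : ℝ) ≤ 4 ^ n := one_le_pow₀ (by norm_num)
  push_cast
  calc 2 * (K : ℝ) + 1 ≤ 2 * (2 * 4 ^ n / δ + 1) + 1 := by gcongr
    _ = 4 / δ * 4 ^ n + 3 * 1 := by ring
    _ ≤ 4 / δ * 4 ^ n + 3 * 4 ^ n := by gcongr
    _ = _ := by ring

/-! ### Double-logarithmic rates -/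

theorem logb_four : Real.logb 2 4 = 2 := by
  rw [show (4 : ℝ) = 2 ^ (2 : ℝ) by norm_num, Real.logb_rpow (by norm_num) (by norm_num)]

theorem log2_mono : Monotone log2 := fun _ _ h =>
  EReal.div_le_div_right_of_nonneg (by exact_mod_cast (Real.log_pos one_lt_two).le)
    (ENNReal.log_monotone h)

theorem log2_ofReal {x : ℝ} (hx : 0 < x) : log2 (ENNReal.ofReal x) = (Real.logb 2 x : ℝ) := by
  rw [log2, ENNReal.log_ofReal_of_pos hx, ← EReal.coe_div, Real.logb]

theorem doubleLogRate_mono (n : ℕ) : Monotone (doubleLogRate n) := fun _ _ h =>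
  EReal.div_le_div_right_of_nonneg (by positivity)
    (log2_mono (EReal.toENNReal_le_toENNReal (log2_mono (ENat.toENNReal_le.2 h))))

theorem upperRate_mono {M M' : ℕ → ℕ∞} (h : ∀ n, M n ≤ M' n) : upperRate M ≤ upperRate M' :=
  limsup_le_limsup (Eventually.of_forall fun n => doubleLogRate_mono n (h n))

/-- Passing to an upper bound `L > 0` of `logb 2 m` avoids the value `⊥` at `m = 1`. -/
theorem doubleLogRate_natCast_le (n : ℕ) {m : ℕ} {L : ℝ} (hm : 0 < m) (hL : 0 < L)
    (h : Real.logb 2 m ≤ L) : doubleLogRate n m ≤ ((Real.logb 2 L / n : ℝ) : EReal) := by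
  have h1 : log2 ((m : ℕ∞) : ℝ≥0∞) ≤ (L : EReal) := by
    have : ((m : ℕ∞) : ℝ≥0∞) = ENNReal.ofReal m := by simp
    rw [this, log2_ofReal (by exact_mod_cast hm)]
    exact_mod_cast h
  have h2 := log2_mono (EReal.toENNReal_le_toENNReal h1)
  rw [EReal.real_coe_toENNReal, log2_ofReal hL] at h2
  rw [EReal.coe_div]
  exact EReal.div_le_div_right_of_nonneg (by positivity) h2

theorem tendsto_logb_mul_div (b R : ℝ) (hb : 0 < b) :
    Tendsto (fun n : ℕ => Real.logb 2 (b * (n + 1) * 2 ^ (R * n)) / n) atTop (𝓝 R) := by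
  have h0 : Tendsto (fun n : ℕ => Real.logb 2 b / n) atTop (𝓝 0) :=
    tendsto_const_div_atTop_nhds_zero_nat _
  have h1 : Tendsto (fun n : ℕ => Real.logb 2 (n + 1) / n) atTop (𝓝 0) := by
    have hlog : Tendsto (fun x : ℝ => Real.log x / (1 * x + -1)) atTop (𝓝 0) := by
      simpa using Real.tendsto_pow_log_div_mul_add_atTop 1 (-1) 1 one_ne_zero
    have := (hlog.comp
      (tendsto_atTop_add_const_right atTop 1 tendsto_natCast_atTop_atTop)).div_const (Real.log 2)
    rw [zero_div] at this
    refine this.congr fun n => ?_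
    simp only [Function.comp, Real.logb, one_mul, add_neg_cancel_right]
    ring
  have := (h0.add h1).add_const R
  rw [add_zero, zero_add] at this
  refine this.congr' ?_
  filter_upwards [eventually_gt_atTop 0] with n hn
  have hn' : (n : ℝ) ≠ 0 := by positivity
  rw [Real.logb_mul (by positivity) (by positivity), Real.logb_mul (by positivity) (by positivity),
    Real.logb_rpow (by norm_num) (by norm_num)]
  field_simp

theorem upperRate_le_of_logb_le {M : ℕ → ℕ∞} {m : ℕ → ℕ} {b R : ℝ} (hb : 0 < b)
    (hM : ∀ n, M n ≤ m n) (hm0 : ∀ n, 0 < m n)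
    (hm : ∀ n : ℕ, Real.logb 2 (m n) ≤ b * (n + 1) * 2 ^ (R * n)) :
    upperRate M ≤ (R : EReal) := by
  have h := (EReal.tendsto_coe.2 (tendsto_logb_mul_div b R hb)).limsup_eq
  rw [← h]
  refine limsup_le_limsup (Eventually.of_forall fun n => ?_)
  exact (doubleLogRate_mono n (hM n)).trans
    (doubleLogRate_natCast_le n (hm0 n) (by positivity) (hm n))

/-- An exponential bound on the number of Pauli strings on which the channel is not strongly
contracting bounds the identification rate. -/
theorem upperRate_maxSize_depolarizing_le {p : ℝ} (hp0 : 0 ≤ p) (hp1 : p < 1) {lam₁ lam₂ : ℝ}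
    (hlam : lam₁ + lam₂ < 1) (S : ∀ n, Finset (Fin n → Fin 4))
    (hS : ∀ n, ∀ s ∉ S n, ((1 - p) ^ weight s) ^ 2 * 2 ^ n ≤ (1 - lam₁ - lam₂) ^ 2 / 8)
    {a R : ℝ} (ha : 0 < a) (hcard : ∀ n : ℕ, ((S n).card : ℝ) ≤ a * 2 ^ (R * n)) :
    upperRate (fun n => maxSize (depolarizing p) n lam₁ lam₂) ≤ (R : EReal) := by
  set c := 4 / (1 - lam₁ - lam₂) + 3 with hc
  have hc3 : 3 ≤ c := by
    have : 0 < 4 / (1 - lam₁ - lam₂) := div_pos four_pos (by linarith)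
    linarith
  have hc1 : ∀ n : ℕ, 1 ≤ c * 4 ^ n := fun n =>
    one_le_mul_of_one_le_of_one_le (by linarith) (one_le_pow₀ (by norm_num))
  have hlogc : 0 < Real.logb 2 c := Real.logb_pos one_lt_two (by linarith)
  have hpos : ∀ n : ℕ, 0 < ⌊c * 4 ^ n⌋₊ := fun n => Nat.floor_pos.2 (hc1 n)
  refine upperRate_le_of_logb_le (m := fun n => ⌊c * 4 ^ n⌋₊ ^ (S n).card)
    (b := a * (2 + Real.logb 2 c)) (by positivity) (fun n => ?_) (fun n => pow_pos (hpos n) _)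
    (fun n => ?_)
  · refine iSup₂_le fun N ⟨ρ, D, h⟩ => ?_
    exact_mod_cast h.size_le hp0 hp1 hlam (S n) (hS n)
  · have h1 : Real.logb 2 ⌊c * 4 ^ n⌋₊ ≤ Real.logb 2 c + n * 2 := by
      rw [show (n : ℝ) * 2 = n * Real.logb 2 4 by rw [logb_four], ← Real.logb_pow 2 4 n,
        ← Real.logb_mul (by positivity) (by positivity)]
      exact Real.logb_le_logb_of_le one_lt_two (by exact_mod_cast hpos n)
        (Nat.floor_le (by positivity))
    push_cast
    rw [Real.logb_pow]
    calc ((S n).card : ℝ) * Real.logb 2 ⌊c * 4 ^ n⌋₊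
        ≤ a * 2 ^ (R * n) * (Real.logb 2 c + n * 2) := by
          gcongr
          · exact Real.logb_nonneg one_lt_two (by exact_mod_cast hpos n)
          · exact hcard n
      _ ≤ a * 2 ^ (R * n) * ((2 + Real.logb 2 c) * (n + 1)) := by
          gcongr
          nlinarith [mul_nonneg hlogc.le (Nat.cast_nonneg (α := ℝ) n)]
      _ = _ := by ring

/-! ### Low-weight Pauli strings and the two rate bounds -/

/-- The Chernoff bound for the number of Pauli strings of weight at most `κ`. -/
theorem card_filter_weight_le {n : ℕ} {x κ : ℝ} (hx : 1 ≤ x) :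
    ((Finset.univ.filter fun s : Fin n → Fin 4 => (weight s : ℝ) ≤ κ).card : ℝ) ≤
      x ^ κ * (1 + 3 / x) ^ n := by
  have hx0 : 0 < x := by linarith
  -- The weight enumerator factorizes: each tensor factor is one identity and three other Paulis.
  have hgen : ∑ s : Fin n → Fin 4, x⁻¹ ^ weight s = (1 + 3 / x) ^ n := by
    simp_rw [← prod_ite_eq_pow_weight]
    rw [← Fintype.piFinset_univ,
      Finset.sum_prod_piFinset Finset.univ fun _ t => if t = 0 then 1 else x⁻¹]
    simp only [Fin.sum_univ_four, Finset.prod_const, Finset.card_univ, Fintype.card_fin]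
    rw [if_pos trivial, if_neg (by decide), if_neg (by decide), if_neg (by decide)]
    ring
  rw [← hgen, Finset.mul_sum, ← nsmul_one, ← Finset.sum_const]
  calc _ ≤ ∑ s ∈ Finset.univ.filter fun s : Fin n → Fin 4 => (weight s : ℝ) ≤ κ,
          x ^ κ * x⁻¹ ^ weight s := Finset.sum_le_sum fun s hs => by
        rw [inv_pow, ← Real.rpow_natCast, ← Real.rpow_neg hx0.le, ← Real.rpow_add hx0]
        exact Real.one_le_rpow hx (by linarith [(Finset.mem_filter.1 hs).2])
    _ ≤ _ := Finset.sum_le_sum_of_subset_of_nonneg (Finset.filter_subset _ _)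
        fun s _ _ => by positivity

/-- The value of the Chernoff exponent at the optimal parameter `x = 3 (1 - γ) / γ`. -/
theorem rpow_mul_eq_two_rpow {γ : ℝ} (h0 : 0 < γ) (h1 : γ < 1) :
    (3 * (1 - γ) / γ) ^ γ * (1 + 3 / (3 * (1 - γ) / γ)) =
      (2 : ℝ) ^ (2 - binRelEntropy γ (3 / 4)) := by
  have h2 : 0 < 1 - γ := by linarith
  have hsum : 1 + 3 / (3 * (1 - γ) / γ) = (1 - γ)⁻¹ := by field_simp; ring
  have hthree : (1 - 3 / 4 : ℝ) = 4⁻¹ := by norm_num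
  rw [hsum, ← Real.rpow_logb two_pos (by norm_num) (x := _ * _) (by positivity)]
  congr 1
  rw [binRelEntropy, hthree, Real.logb_mul (by positivity) (by positivity),
    Real.logb_rpow_eq_mul_logb_of_pos (by positivity), Real.logb_inv,
    Real.logb_div (by positivity) (by positivity), Real.logb_mul (by positivity) (by positivity),
    Real.logb_div (by positivity) (by positivity), Real.logb_div (by positivity) (by positivity),
    Real.logb_div (by positivity) (by positivity), Real.logb_inv, logb_four]
  ring

theorem gammaParam_mem {p : ℝ} (hp : 1 - (2 : ℝ) ^ (-2 / 3 : ℝ) ≤ p) (hp1 : p < 1) :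
    0 < gammaParam p ∧ gammaParam p ≤ 3 / 4 := by
  have hq : 0 < 1 - p := by linarith
  have hlog : Real.logb 2 (1 - p) ≤ -2 / 3 :=
    (Real.logb_le_iff_le_rpow one_lt_two hq).2 (by linarith)
  rw [gammaParam]
  refine ⟨div_pos_of_neg_of_neg (by norm_num) (by linarith), ?_⟩
  rw [div_le_iff_of_neg (by linarith)]
  linarith

/-- At weight `γ(p) n` the contraction of a Pauli string cancels the dimension factor. -/
theorem rpow_gammaParam {p : ℝ} (hp0 : 0 < p) (hp1 : p < 1) (n : ℕ) :
    ((1 - p) ^ (gammaParam p * n)) ^ 2 * 2 ^ n = 1 := by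
  have hq : 0 < 1 - p := by linarith
  have hlog : Real.logb 2 (1 - p) < 0 := Real.logb_neg one_lt_two hq (by linarith)
  have h : (1 - p) ^ (gammaParam p * n) = (2 : ℝ) ^ (-(n : ℝ) / 2) := by
    conv_lhs => rw [← Real.rpow_logb two_pos (by norm_num) hq]
    rw [← Real.rpow_mul zero_le_two, gammaParam]
    congr 1
    have := hlog.ne
    field_simp
  rw [h, ← Real.rpow_natCast, ← Real.rpow_natCast, ← Real.rpow_mul zero_le_two,
    ← Real.rpow_add two_pos]
  ring_nf
  simp

/-- All `4 ^ n` Pauli strings are used, so nothing is required of the contraction. -/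
theorem upperRate_maxSize_depolarizing_le_two {p : ℝ} (hp0 : 0 ≤ p) (hp1 : p < 1)
    {lam₁ lam₂ : ℝ} (hlam : lam₁ + lam₂ < 1) :
    upperRate (fun n => maxSize (depolarizing p) n lam₁ lam₂) ≤ 2 := by
  refine upperRate_maxSize_depolarizing_le hp0 hp1 hlam (R := 2) (fun _ => Finset.univ)
    (fun n s hs => absurd (Finset.mem_univ s) hs) one_pos fun n => ?_
  rw [Real.rpow_mul zero_le_two, Real.rpow_natCast]
  norm_num

theorem upperRate_maxSize_depolarizing_le_sub_binRelEntropy {p : ℝ}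
    (hp : 1 - (2 : ℝ) ^ (-2 / 3 : ℝ) ≤ p) (hp1 : p < 1) {lam₁ lam₂ : ℝ}
    (hlam : lam₁ + lam₂ < 1) :
    upperRate (fun n => maxSize (depolarizing p) n lam₁ lam₂) ≤
      ((2 - binRelEntropy (gammaParam p) (3 / 4) : ℝ) : EReal) := by
  have hp0 : 0 < p := by
    have : (2 : ℝ) ^ (-2 / 3 : ℝ) < 1 := Real.rpow_lt_one_of_one_lt_of_neg one_lt_two (by norm_num)
    linarith
  have hq : 0 < 1 - p := by linarith
  obtain ⟨hγ0, hγ1⟩ := gammaParam_mem hp hp1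
  set γ := gammaParam p with hγ
  have hδ : 0 < (1 - lam₁ - lam₂) ^ 2 / 8 := by
    have : 0 < 1 - lam₁ - lam₂ := by linarith
    positivity
  -- A constant excess `c` over the weight `γ n` makes the tail as small as the errors require.
  obtain ⟨c, hc⟩ := exists_pow_lt_of_lt_one hδ (y := (1 - p) ^ 2)
    (pow_lt_one₀ hq.le (by linarith) two_ne_zero)
  set x := 3 * (1 - γ) / γ with hx
  have hx1 : 1 ≤ x := by rw [hx, le_div_iff₀ hγ0]; linarith
  have hx0 : 0 < x := by linarith
  refine upperRate_maxSize_depolarizing_le hp0.le hp1 hlam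
    (fun n => Finset.univ.filter fun s => (weight s : ℝ) ≤ γ * n + c) (fun n s hs => ?_)
    (a := x ^ c) (by positivity) fun n => ?_
  · have hw : γ * n + c ≤ weight s := by
      simpa using (not_le.1 fun h => hs (Finset.mem_filter.2 ⟨Finset.mem_univ s, h⟩)).le
    have h1 : (1 - p) ^ weight s ≤ (1 - p) ^ (γ * n) * (1 - p) ^ c := by
      rw [← Real.rpow_natCast, ← Real.rpow_natCast, ← Real.rpow_add hq]
      exact Real.rpow_le_rpow_of_exponent_ge hq (by linarith) hw
    calc ((1 - p) ^ weight s) ^ 2 * 2 ^ n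
        ≤ ((1 - p) ^ (γ * n) * (1 - p) ^ c) ^ 2 * 2 ^ n := by gcongr
      _ = ((1 - p) ^ (γ * n)) ^ 2 * 2 ^ n * ((1 - p) ^ 2) ^ c := by
          rw [mul_pow, ← pow_mul, ← pow_mul, mul_comm 2 c]
          ring
      _ ≤ _ := by rw [rpow_gammaParam hp0 hp1, one_mul]; exact hc.le
  · refine (card_filter_weight_le hx1).trans_eq ?_
    rw [Real.rpow_mul zero_le_two, ← rpow_mul_eq_two_rpow hγ0 (by linarith), Real.rpow_natCast,
      mul_pow, Real.rpow_add hx0, Real.rpow_mul hx0.le, Real.rpow_natCast, Real.rpow_natCast]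
    ring

/-! ### The limit of the bound as `p → 1` -/

theorem tendsto_gammaParam : Tendsto gammaParam (𝓝[<] 1) (𝓝 0) := by
  have h1 : Tendsto (fun p : ℝ => 1 - p) (𝓝[<] 1) (𝓝[>] 0) := by
    refine tendsto_nhdsWithin_iff.2 ⟨?_, ?_⟩
    · have : Tendsto (fun p : ℝ => 1 - p) (𝓝 1) (𝓝 (1 - 1)) := by
        exact (continuous_const.sub continuous_id).tendsto 1
      rw [sub_self] at this
      exact this.mono_left nhdsWithin_le_nhds
    · filter_upwards [self_mem_nhdsWithin] with p hp
      exact sub_pos.2 (Set.mem_Iio.1 hp)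
  have h2 := (Real.tendsto_logb_nhdsGT_zero one_lt_two).comp h1
  have h3 := (h2.const_mul_atBot two_pos).const_div_atBot (-1)
  exact h3

theorem tendsto_binRelEntropy_zero :
    Tendsto (fun x => binRelEntropy x (3 / 4)) (𝓝 0) (𝓝 2) := by
  -- Splitting the logarithms also holds at `x = 0`, where `x * logb 2 (x / (3 / 4))` is `0`.
  have heq : ∀ x : ℝ, x ≠ 1 → binRelEntropy x (3 / 4) =
      (x * Real.log x + (1 - x) * Real.log (1 - x)) / Real.log 2 -
        x * Real.logb 2 (3 / 4) + (1 - x) * 2 := fun x hx1 => by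
    have h2 : (1 - 3 / 4 : ℝ) = 4⁻¹ := by norm_num
    have h3 : 1 - x ≠ 0 := sub_ne_zero.2 (Ne.symm hx1)
    rw [binRelEntropy, h2, Real.logb_div h3 (by norm_num), Real.logb_inv, logb_four]
    rcases eq_or_ne x 0 with rfl | hx
    · simp
    · rw [Real.logb_div hx (by norm_num)]
      simp only [Real.logb]
      ring
  have hcont : Continuous fun x : ℝ =>
      (x * Real.log x + (1 - x) * Real.log (1 - x)) / Real.log 2 -
        x * Real.logb 2 (3 / 4) + (1 - x) * 2 := by
    have h1 := Real.continuous_mul_log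
    have h2 := h1.comp (continuous_const.sub continuous_id : Continuous fun x : ℝ => 1 - x)
    exact (((h1.add h2).div_const _).sub (continuous_id.mul continuous_const)).add
      ((continuous_const.sub continuous_id).mul continuous_const)
  have h := hcont.tendsto 0
  simp only [zero_mul, sub_zero, Real.log_one, mul_zero, add_zero, zero_div, one_mul,
    zero_add] at h
  refine h.congr' ?_
  filter_upwards [isOpen_ne.mem_nhds (zero_ne_one (α := ℝ))] with x hx
  exact (heq x hx).symm

/-! ### Capacities and simultaneous codes -/

theorem maxSimSize_le_maxSize {A B : Type*} [Fintype A] [DecidableEq A] [Fintype B]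
    [DecidableEq B] (Φ : Matrix A A ℂ →ₗ[ℂ] Matrix B B ℂ) (n : ℕ) (lam₁ lam₂ : ℝ) :
    maxSimSize Φ n lam₁ lam₂ ≤ maxSize Φ n lam₁ lam₂ :=
  iSup₂_le fun N ⟨ρ, D, h, _⟩ => le_iSup₂_of_le N ⟨ρ, D, h⟩ le_rfl

theorem lowerRate_le_upperRate (N : ℕ → ℕ∞) : lowerRate N ≤ upperRate N :=
  liminf_le_limsup

theorem idCapacity_le_upperRate {A B : Type*} [Fintype A] [DecidableEq A] [Fintype B]
    [DecidableEq B] (Φ : Matrix A A ℂ →ₗ[ℂ] Matrix B B ℂ) {lam₁ lam₂ : ℝ} (h₁ : 0 < lam₁)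
    (h₂ : 0 < lam₂) : idCapacity Φ ≤ upperRate fun n => maxSize Φ n lam₁ lam₂ :=
  (iInf₂_le_of_le lam₁ h₁ (iInf₂_le lam₂ h₂)).trans (lowerRate_le_upperRate _)

theorem simIdCapacity_le_upperRate {A B : Type*} [Fintype A] [DecidableEq A] [Fintype B]
    [DecidableEq B] (Φ : Matrix A A ℂ →ₗ[ℂ] Matrix B B ℂ) {lam₁ lam₂ : ℝ} (h₁ : 0 < lam₁)
    (h₂ : 0 < lam₂) : simIdCapacity Φ ≤ upperRate fun n => maxSimSize Φ n lam₁ lam₂ :=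
  (iInf₂_le_of_le lam₁ h₁ (iInf₂_le lam₂ h₂)).trans (lowerRate_le_upperRate _)

end QuantumId

open QuantumId in
theorem mainTheorem2 :
    (∀ p : ℝ, 0 ≤ p → p < 1 → ∀ lam₁ lam₂ : ℝ, 0 < lam₁ → 0 < lam₂ → lam₁ + lam₂ < 1 →
      (QuantumId.idCapacity (QuantumId.depolarizing p) ≤
          QuantumId.upperRate (fun n => QuantumId.maxSize (QuantumId.depolarizing p) n lam₁ lam₂) ∧
        (p ≤ 1 - (2 : ℝ) ^ (-2 / 3 : ℝ) →
          QuantumId.upperRate (fun n => QuantumId.maxSize (QuantumId.depolarizing p) n lam₁ lam₂) ≤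
            2) ∧
        (1 - (2 : ℝ) ^ (-2 / 3 : ℝ) ≤ p →
          QuantumId.upperRate (fun n => QuantumId.maxSize (QuantumId.depolarizing p) n lam₁ lam₂) ≤
            ((2 - QuantumId.binRelEntropy (QuantumId.gammaParam p) (3 / 4) : ℝ) : EReal))) ∧
      (QuantumId.simIdCapacity (QuantumId.depolarizing p) ≤
          QuantumId.upperRate
            (fun n => QuantumId.maxSimSize (QuantumId.depolarizing p) n lam₁ lam₂) ∧
        (p ≤ 1 - (2 : ℝ) ^ (-2 / 3 : ℝ) →
          QuantumId.upperRate
            (fun n => QuantumId.maxSimSize (QuantumId.depolarizing p) n lam₁ lam₂) ≤ 2) ∧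
        (1 - (2 : ℝ) ^ (-2 / 3 : ℝ) ≤ p →
          QuantumId.upperRate
            (fun n => QuantumId.maxSimSize (QuantumId.depolarizing p) n lam₁ lam₂) ≤
            ((2 - QuantumId.binRelEntropy (QuantumId.gammaParam p) (3 / 4) : ℝ) : EReal)))) ∧
    Tendsto (fun p : ℝ => 2 - QuantumId.binRelEntropy (QuantumId.gammaParam p) (3 / 4))
      (𝓝[<] 1) (𝓝 0) := by
  refine ⟨fun p hp0 hp1 lam₁ lam₂ h₁ h₂ hlam => ?_, ?_⟩
  · have hsim : upperRate (fun n => maxSimSize (depolarizing p) n lam₁ lam₂) ≤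
        upperRate (fun n => maxSize (depolarizing p) n lam₁ lam₂) :=
      upperRate_mono fun n => maxSimSize_le_maxSize _ n lam₁ lam₂
    have htwo := upperRate_maxSize_depolarizing_le_two hp0 hp1 hlam
    have hent := fun hp : 1 - (2 : ℝ) ^ (-2 / 3 : ℝ) ≤ p =>
      upperRate_maxSize_depolarizing_le_sub_binRelEntropy hp hp1 hlam
    exact ⟨⟨idCapacity_le_upperRate _ h₁ h₂, fun _ => htwo, hent⟩,
      ⟨simIdCapacity_le_upperRate _ h₁ h₂, fun _ => hsim.trans htwo,
        fun hp => hsim.trans (hent hp)⟩⟩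
  · have h := (tendsto_binRelEntropy_zero.comp tendsto_gammaParam).const_sub 2
    rwa [sub_self] at h
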